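/- For integers $n, m \ge 0$ let $cp_{1-2}(n,m)$ be the number of partitions of $n$ into exactly $m$ parts such that any two successive parts differ by at least $2$, and differ by at least $4$ unless their sum is $\equiv 2 \pmod 3$. Then, as an identity of formal power series in $q$ and $x$, $$\sum_{m,n\ge 0} cp_{1-2}(n,m)\, q^n x^m \;=\; \sum_{n_1,n_2\ge 0} \frac{q^{6n_2^2-n_2+2n_1^2-n_1+6n_2n_1}\, x^{2n_2+n_1}}{(q;q)_{n_1}\,(q^3;q^3)_{n_2}},$$ where $(a;b)_n=\prod_{j=1}^{n}(1-ab^{j-1})$, with empty product $1$. -/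

import Mathlib

namespace CapparelliOneTwo

open MvPowerSeries

/-- A partition of `n` is admissible if, listing its parts in increasing order, any two successive
parts `a ≤ b` satisfy `b - a ≥ 2`, and moreover `b - a ≥ 4` unless `a + b ≡ 2 (mod 3)`. -/
def Admissible {n : ℕ} (p : n.Partition) : Prop :=
  (p.parts.sort (· ≤ ·)).IsChain
    (fun a b => a + 2 ≤ b ∧ (¬ a + b ≡ 2 [MOD 3] → a + 4 ≤ b))

instance {n : ℕ} (p : n.Partition) : Decidable (Admissible p) := by
  unfold Admissible; infer_instance

/-- The number of admissible partitions of `n` into exactly `m` parts. -/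
def cp (n m : ℕ) : ℕ :=
  (Finset.univ.filter (fun p : n.Partition => Admissible p ∧ p.parts.card = m)).card

/-- Formal power series with integer coefficients in two commuting variables: `q` is the variable
of index `0` and `x` the variable of index `1`. -/
abbrev Series : Type := MvPowerSeries (Fin 2) ℤ

/-- The variable marking the sum of the parts. -/
noncomputable def q : Series := X 0

/-- The variable marking the number of parts. -/
noncomputable def x : Series := X 1

/-- The generating function of `cp`: the coefficient of `q ^ n * x ^ m` is `cp n m`. -/
def genFun : Series := fun d => (cp (d 0) (d 1) : ℤ)

theorem coeff_genFun (d : Fin 2 →₀ ℕ) : coeff d genFun = (cp (d 0) (d 1) : ℤ) := rfl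

/-- The finite `q`-Pochhammer symbol `(a; b)_n`, the product of `1 - a * b ^ (j - 1)` over
`1 ≤ j ≤ n`. -/
noncomputable def pochhammer (a b : Series) (n : ℕ) : Series :=
  ∏ j ∈ Finset.Icc 1 n, (1 - a * b ^ (j - 1))

/-- The multiplicative inverse of `(q; q)_{n₁} (q³; q³)_{n₂}`, a power series with constant
coefficient `1` (see `pochhammer_mul_inverse`). -/
noncomputable def inverseDenominator (n₁ n₂ : ℕ) : Series :=
  invOfUnit (pochhammer q q n₁ * pochhammer (q ^ 3) (q ^ 3) n₂) 1

theorem constantCoeff_pochhammer (k n : ℕ) (hk : k ≠ 0) :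
    constantCoeff (pochhammer (q ^ k) (q ^ k) n) = 1 := by
  simp [pochhammer, q, map_prod, hk]

theorem pochhammer_mul_inverse (n₁ n₂ : ℕ) :
    (pochhammer q q n₁ * pochhammer (q ^ 3) (q ^ 3) n₂) *
      inverseDenominator n₁ n₂ = 1 := by
  apply mul_invOfUnit
  have h1 := constantCoeff_pochhammer 1 n₁ one_ne_zero
  have h3 := constantCoeff_pochhammer 3 n₂ (by norm_num)
  rw [pow_one] at h1
  rw [map_mul, h1, h3]
  simp

/-- The natural-number subtractions in the exponent of the double series never truncate. -/
theorem exponent_cast (n₁ n₂ : ℕ) :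
    (((6 * n₂ ^ 2 - n₂) + (2 * n₁ ^ 2 - n₁) + 6 * n₂ * n₁ : ℕ) : ℤ) =
      6 * (n₂ : ℤ) ^ 2 - n₂ + 2 * (n₁ : ℤ) ^ 2 - n₁ + 6 * n₂ * n₁ := by
  have h1 : n₂ ≤ 6 * n₂ ^ 2 := by nlinarith [Nat.le_self_pow two_ne_zero n₂]
  have h2 : n₁ ≤ 2 * n₁ ^ 2 := by nlinarith [Nat.le_self_pow two_ne_zero n₁]
  push_cast [Nat.cast_sub h1, Nat.cast_sub h2]
  ring

end CapparelliOneTwo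

-- The topology of coefficientwise convergence, with the discrete topology on the integers.
open scoped MvPowerSeries.WithPiTopology

/-! Both sides satisfy the same `q`-difference system, which has only one solution. Put `F(i, j)`
for the double series weighted by `q ^ (i * n₁ + j * n₂)`. Cancelling the last factor of a
Pochhammer symbol gives one recurrence in `i` and one in `j`. On the partition side, removing the
smallest part, according to its residue mod 3, gives the system `IsSolution`. The triple `F(3t,
6t)`, `F(3t+1, 6t+3)`, `F(3t+2, 6t+3)` solves it too, and `IsSolution.unique` at `t = 0` gives the
identity. -/

namespace CapparelliOneTwo

open MvPowerSeries

/-! ### Recurrences for the weighted double series -/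

/-- The summand of the double series, with an extra factor `q ^ (i * n₁ + j * n₂)`. -/
noncomputable def summand (i j : ℕ) (n : ℕ × ℕ) : Series :=
  q ^ ((6 * n.2 ^ 2 - n.2) + (2 * n.1 ^ 2 - n.1) + 6 * n.2 * n.1 + i * n.1 + j * n.2) *
    x ^ (2 * n.2 + n.1) * inverseDenominator n.1 n.2

theorem summand_zero (i j : ℕ) : summand i j (0, 0) = 1 := by
  have h := pochhammer_mul_inverse 0 0
  simp only [pochhammer, Finset.Icc_eq_empty_of_lt zero_lt_one, Finset.prod_empty, one_mul] at h
  simp [summand, h]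

theorem pochhammer_succ (a b : Series) (n : ℕ) :
    pochhammer a b (n + 1) = pochhammer a b n * (1 - a * b ^ n) := by
  simp [pochhammer, Finset.prod_Icc_succ_top]

theorem inverseDenominator_succ_left (a b : ℕ) :
    (1 - q ^ (a + 1)) * inverseDenominator (a + 1) b = inverseDenominator a b := by
  have h1 := pochhammer_mul_inverse (a + 1) b
  have h2 := pochhammer_mul_inverse a b
  rw [pochhammer_succ] at h1
  linear_combination (-(1 - q ^ (a + 1)) * inverseDenominator (a + 1) b) * h2 +
    inverseDenominator a b * h1

theorem inverseDenominator_succ_right (a b : ℕ) :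
    (1 - q ^ (3 * (b + 1))) * inverseDenominator a (b + 1) = inverseDenominator a b := by
  have h1 := pochhammer_mul_inverse a (b + 1)
  have h2 := pochhammer_mul_inverse a b
  rw [pochhammer_succ, ← pow_succ', ← pow_mul] at h1
  linear_combination (-(1 - q ^ (3 * (b + 1))) * inverseDenominator a (b + 1)) * h2 +
    inverseDenominator a b * h1

theorem two_mul_sq_sub_succ (a : ℕ) :
    2 * (a + 1) ^ 2 - (a + 1) = (2 * a ^ 2 - a) + 4 * a + 1 := by
  have h : a ≤ a ^ 2 := Nat.le_self_pow two_ne_zero a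
  have h' : (a + 1) ^ 2 = a ^ 2 + 2 * a + 1 := by ring
  omega

theorem six_mul_sq_sub_succ (b : ℕ) :
    6 * (b + 1) ^ 2 - (b + 1) = (6 * b ^ 2 - b) + 12 * b + 5 := by
  have h : b ≤ b ^ 2 := Nat.le_self_pow two_ne_zero b
  have h' : (b + 1) ^ 2 = b ^ 2 + 2 * b + 1 := by ring
  omega

/-- The difference carries the factor `1 - q ^ (a + 1)`, which cancels the last factor of `(q;
q)_{a+1}`; the growth of the quadratic exponent becomes the shift of `i` and `j`. -/
theorem summand_sub_succ_left (i j a b : ℕ) :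
    summand i j (a + 1, b) - summand (i + 1) j (a + 1, b) =
      x * q ^ (i + 1) * summand (i + 4) (j + 6) (a, b) := by
  simp only [summand, two_mul_sq_sub_succ, ← inverseDenominator_succ_left a b]
  ring

theorem summand_sub_succ_right (i j a b : ℕ) :
    summand i j (a, b + 1) - summand i (j + 3) (a, b + 1) =
      x ^ 2 * q ^ (j + 5) * summand (i + 6) (j + 12) (a, b) := by
  simp only [summand, six_mul_sq_sub_succ, ← inverseDenominator_succ_right a b]
  ring

theorem coeff_summand_eq_zero_of_lt (i j : ℕ) (n : ℕ × ℕ) (d : Fin 2 →₀ ℕ)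
    (h : d 1 < 2 * n.2 + n.1) : coeff d (summand i j n) = 0 := by
  refine X_pow_dvd_iff.1 ?_ d h
  exact Dvd.dvd.mul_right (Dvd.intro_left _ rfl) _

theorem coeff_summand_eq_zero_of_ne (i j : ℕ) (n : ℕ × ℕ) (hn : n ≠ (0, 0)) (d : Fin 2 →₀ ℕ)
    (hi : d 0 < i) (hj : d 0 < j) : coeff d (summand i j n) = 0 := by
  have h : d 0 <
      (6 * n.2 ^ 2 - n.2) + (2 * n.1 ^ 2 - n.1) + 6 * n.2 * n.1 + i * n.1 + j * n.2 := by
    obtain ⟨a, b⟩ := n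
    rcases Nat.eq_zero_or_pos a with rfl | ha
    · have hb : 0 < b := Nat.pos_of_ne_zero fun hb => hn (by rw [hb])
      have := Nat.le_mul_of_pos_right j hb
      dsimp only
      omega
    · have := Nat.le_mul_of_pos_right i ha
      dsimp only
      omega
  refine X_pow_dvd_iff.1 ?_ d h
  exact Dvd.dvd.mul_right (Dvd.intro _ rfl) _

theorem summable_summand (i j : ℕ) : Summable (summand i j) := by
  rw [WithPiTopology.summable_iff_summable_coeff]
  intro d
  -- The factor `x ^ (2 * n₂ + n₁)` leaves finitely many terms for each coefficient.
  refine summable_of_hasFiniteSupport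
    (((Finset.range (d 1 + 1)) ×ˢ (Finset.range (d 1 + 1))).finite_toSet.subset fun n hn => ?_)
  by_contra hmem
  refine hn (coeff_summand_eq_zero_of_lt i j n d ?_)
  simp only [Finset.coe_product, Set.mem_prod, Finset.mem_coe, Finset.mem_range] at hmem
  omega

/-- The double series, with an extra factor `q ^ (i * n₁ + j * n₂)` in each term. -/
noncomputable def doubleSeries (i j : ℕ) : Series := ∑' n, summand i j n

theorem hasSum_doubleSeries (i j : ℕ) : HasSum (summand i j) (doubleSeries i j) :=
  (summable_summand i j).hasSum

theorem doubleSeries_left (i j : ℕ) :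
    doubleSeries i j = doubleSeries (i + 1) j + x * q ^ (i + 1) * doubleSeries (i + 4) (j + 6) := by
  rw [← sub_eq_iff_eq_add']
  refine ((hasSum_doubleSeries i j).sub (hasSum_doubleSeries (i + 1) j)).unique ?_
  have hinj : Function.Injective fun n : ℕ × ℕ => (n.1 + 1, n.2) := by
    rintro ⟨a, b⟩ ⟨c, d⟩ h
    simpa using h
  refine (hinj.hasSum_iff ?_).1 ?_
  · rintro ⟨a, b⟩ h
    cases a with
    -- At `n₁ = 0` the weight `i` is invisible, so the two terms cancel.
    | zero => simp [summand]
    | succ a => exact absurd ⟨(a, b), rfl⟩ h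
  · refine ((hasSum_doubleSeries (i + 4) (j + 6)).mul_left (x * q ^ (i + 1))).congr_fun ?_
    exact fun n => summand_sub_succ_left i j n.1 n.2

theorem doubleSeries_right (i j : ℕ) :
    doubleSeries i j =
      doubleSeries i (j + 3) + x ^ 2 * q ^ (j + 5) * doubleSeries (i + 6) (j + 12) := by
  rw [← sub_eq_iff_eq_add']
  refine ((hasSum_doubleSeries i j).sub (hasSum_doubleSeries i (j + 3))).unique ?_
  have hinj : Function.Injective fun n : ℕ × ℕ => (n.1, n.2 + 1) := by
    rintro ⟨a, b⟩ ⟨c, d⟩ h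
    simpa using h
  refine (hinj.hasSum_iff ?_).1 ?_
  · rintro ⟨a, b⟩ h
    cases b with
    | zero => simp [summand]
    | succ b => exact absurd ⟨(a, b), rfl⟩ h
  · refine ((hasSum_doubleSeries (i + 6) (j + 12)).mul_left (x ^ 2 * q ^ (j + 5))).congr_fun ?_
    exact fun n => summand_sub_succ_right i j n.1 n.2

theorem coeff_doubleSeries_of_lt (i j : ℕ) (d : Fin 2 →₀ ℕ) (hi : d 0 < i) (hj : d 0 < j) :
    coeff d (doubleSeries i j) = coeff d 1 := by
  have h := WithPiTopology.hasSum_iff_hasSum_coeff.1 (hasSum_doubleSeries i j) d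
  refine h.unique ?_
  rw [← summand_zero i j]
  exact hasSum_single (0, 0) fun n hn => coeff_summand_eq_zero_of_ne i j n hn d hi hj

/-! ### The `q`-difference system and its uniqueness -/

/-- The system of `q`-difference equations for the generating functions `A t`, `B t`, `C t` of
admissible partitions with parts at least `3 t + 1`, `3 t + 2`, `3 t + 3`. -/
structure IsSolution (A B C : ℕ → Series) : Prop where
  eq_A : ∀ t, A t = B t + x * q ^ (3 * t + 1) * A (t + 1)
  eq_B : ∀ t, B t = C t + x * q ^ (3 * t + 2) * C (t + 1)
  eq_C : ∀ t, C t = A (t + 1) +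
    x * q ^ (3 * t + 3) * (A (t + 2) + x * q ^ (3 * t + 5) * C (t + 2))
  coeff_A : ∀ t (d : Fin 2 →₀ ℕ), d 0 < t → coeff d (A t) = coeff d 1

theorem isSolution_doubleSeries :
    IsSolution (fun t => doubleSeries (3 * t) (6 * t))
      (fun t => doubleSeries (3 * t + 1) (6 * t + 3))
      (fun t => doubleSeries (3 * t + 2) (6 * t + 3)) where
  eq_A t := by
    have h1 := doubleSeries_left (3 * t) (6 * t)
    have h2 := doubleSeries_right (3 * t + 1) (6 * t)
    have h3 := doubleSeries_left (3 * t + 3) (6 * t + 6)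
    simp only [mul_add, add_assoc, Nat.reduceAdd, Nat.reduceMul] at h1 h2 h3 ⊢
    -- `h3` recombines the two remainder terms of `h1` and `h2` into `A (t + 1)`.
    linear_combination h1 + h2 - x * q ^ (3 * t + 1) * h3
  eq_B t := by
    have h1 := doubleSeries_left (3 * t + 1) (6 * t + 3)
    simp only [mul_add, add_assoc, Nat.reduceAdd, Nat.reduceMul] at h1 ⊢
    exact h1
  eq_C t := by
    have h1 := doubleSeries_left (3 * t + 2) (6 * t + 3)
    have h2 := doubleSeries_right (3 * t + 3) (6 * t + 3)
    have h3 := doubleSeries_right (3 * t + 6) (6 * t + 9)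
    have h4 := doubleSeries_left (3 * t + 8) (6 * t + 15)
    simp only [mul_add, add_assoc, Nat.reduceAdd, Nat.reduceMul] at h1 h2 h3 h4 ⊢
    linear_combination h1 + h2 + x * q ^ (3 * t + 3) * h3 - x ^ 2 * q ^ (6 * t + 8) * h4
  coeff_A t d h := coeff_doubleSeries_of_lt _ _ d (by omega) (by omega)

/-- Terms with a factor `x` involve only `A` and `C`, so agreement mod `x ^ m` makes the differences
of the two solutions constant along `A t, B t, C t, A (t + 1), …` mod `x ^ (m + 1)`. That constant
is zero because `coeff_A` fixes each coefficient of `A t` for large `t`. -/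
theorem IsSolution.x_pow_dvd_sub {A B C A' B' C' : ℕ → Series} (h : IsSolution A B C)
    (h' : IsSolution A' B' C') (m : ℕ) : ∀ t, x ^ m ∣ A t - A' t ∧ x ^ m ∣ C t - C' t := by
  induction m with
  | zero => simp
  | succ m ih =>
    have hBC : ∀ t, x ^ (m + 1) ∣ (B t - B' t) - (C t - C' t) := fun t => by
      rw [h.eq_B, h'.eq_B, pow_succ']
      convert (mul_dvd_mul_left x (ih (t + 1)).2).mul_right (q ^ (3 * t + 2)) using 1
      ring
    have hAB : ∀ t, x ^ (m + 1) ∣ (A t - A' t) - (B t - B' t) := fun t => by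
      rw [h.eq_A, h'.eq_A, pow_succ']
      convert (mul_dvd_mul_left x (ih (t + 1)).1).mul_right (q ^ (3 * t + 1)) using 1
      ring
    have hCA : ∀ t, x ^ (m + 1) ∣ (C t - C' t) - (A (t + 1) - A' (t + 1)) := fun t => by
      rw [h.eq_C, h'.eq_C, pow_succ']
      convert ((mul_dvd_mul_left x (ih (t + 2)).1).mul_right (q ^ (3 * t + 3))).add
        ((mul_dvd_mul_left x (ih (t + 2)).2).mul_right (x * q ^ (3 * t + 3) * q ^ (3 * t + 5)))
        using 1
      ring
    have hstep : ∀ t, x ^ (m + 1) ∣ (A t - A' t) - (A (t + 1) - A' (t + 1)) := fun t => by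
      convert ((hAB t).add (hBC t)).add (hCA t) using 1
      ring
    have hiter : ∀ t N, x ^ (m + 1) ∣ (A t - A' t) - (A (t + N) - A' (t + N)) := fun t N => by
      induction N with
      | zero => simp
      | succ N ihN =>
        convert ihN.add (hstep (t + N)) using 1
        rw [← add_assoc]
        ring
    have hA : ∀ t, x ^ (m + 1) ∣ A t - A' t := fun t => by
      refine X_pow_dvd_iff.2 fun d hd => ?_
      -- With `N = d 0 + 1` the index exceeds `d 0`, so `coeff_A` applies.
      have h1 := X_pow_dvd_iff.1 (hiter t (d 0 + 1)) d hd
      rw [map_sub, map_sub (coeff d) (A (t + _)), h.coeff_A _ d (by omega),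
        h'.coeff_A _ d (by omega), sub_self, sub_zero] at h1
      exact h1
    refine fun t => ⟨hA t, ?_⟩
    convert (hCA t).add (hA (t + 1)) using 1
    ring

theorem IsSolution.unique {A B C A' B' C' : ℕ → Series} (h : IsSolution A B C)
    (h' : IsSolution A' B' C') (t : ℕ) : A t = A' t := by
  ext d
  rw [← sub_eq_zero, ← map_sub]
  exact X_pow_dvd_iff.1 (h.x_pow_dvd_sub h' (d 1 + 1) t).1 d (Nat.lt_succ_self _)

/-! ### Generating functions of admissible sequences -/

theorem finite_setOf_sum_length (n m : ℕ) :
    {l : List ℕ | l.sum = n ∧ l.length = m}.Finite := by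
  refine ((Set.finite_range fun f : Fin m → Fin (n + 1) =>
    List.ofFn fun i => (f i : ℕ))).subset ?_
  rintro l ⟨rfl, rfl⟩
  refine ⟨fun i => ⟨l.get i, Nat.lt_succ_of_le (List.le_sum_of_mem (l.get_mem i))⟩, ?_⟩
  exact List.ofFn_get l

/-- The generating function of a set of lists, by sum and length. -/
noncomputable def listGenFun (P : Set (List ℕ)) : Series :=
  fun d => ((P ∩ {l | l.sum = d 0 ∧ l.length = d 1}).ncard : ℤ)

theorem coeff_listGenFun (P : Set (List ℕ)) (d : Fin 2 →₀ ℕ) :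
    coeff d (listGenFun P) = ((P ∩ {l | l.sum = d 0 ∧ l.length = d 1}).ncard : ℤ) := rfl

theorem listGenFun_union {P Q : Set (List ℕ)} (h : Disjoint P Q) :
    listGenFun (P ∪ Q) = listGenFun P + listGenFun Q := by
  ext d
  rw [map_add, coeff_listGenFun, coeff_listGenFun, coeff_listGenFun, Set.union_inter_distrib_right,
    Set.ncard_union_eq (h.mono Set.inter_subset_left Set.inter_subset_left)
      ((finite_setOf_sum_length _ _).inter_of_right _)
      ((finite_setOf_sum_length _ _).inter_of_right _)]
  push_cast
  rfl

theorem x_mul_q_pow (k : ℕ) :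
    x * q ^ k = monomial (Finsupp.single 1 1 + Finsupp.single 0 k) (1 : ℤ) := by
  rw [x, q, X_pow_eq, X, monomial_mul_monomial, one_mul]

theorem listGenFun_cons (k : ℕ) (P : Set (List ℕ)) :
    listGenFun (List.cons k '' P) = x * q ^ k * listGenFun P := by
  ext d
  rw [x_mul_q_pow, coeff_monomial_mul, one_mul, coeff_listGenFun, coeff_listGenFun]
  have hle : Finsupp.single 1 1 + Finsupp.single 0 k ≤ d ↔ k ≤ d 0 ∧ 1 ≤ d 1 := by
    simp [Finsupp.le_def, Fin.forall_fin_two]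
  split_ifs with h
  · rw [hle] at h
    rw [← Set.ncard_image_of_injective (P ∩ _) (List.cons_injective (a := k))]
    congr 2
    ext l
    simp only [Set.mem_inter_iff, Set.mem_image, Set.mem_ofPred_eq]
    constructor
    · rintro ⟨⟨l, hl, rfl⟩, h0, h1⟩
      refine ⟨l, ⟨hl, ?_, ?_⟩, rfl⟩ <;> simp at h0 h1 ⊢ <;> omega
    · rintro ⟨l, ⟨hl, h0, h1⟩, rfl⟩
      refine ⟨⟨l, hl, rfl⟩, ?_, ?_⟩ <;> simp at h0 h1 ⊢ <;> omega
  · rw [hle] at h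
    rw [Nat.cast_eq_zero, Set.ncard_eq_zero ((finite_setOf_sum_length _ _).inter_of_right _),
      Set.eq_empty_iff_forall_notMem]
    rintro _ ⟨⟨l, hl, rfl⟩, h0, h1⟩
    simp at h0 h1
    omega

/-- The condition on two successive parts of an admissible partition. -/
def Step (a b : ℕ) : Prop := a + 2 ≤ b ∧ (¬ a + b ≡ 2 [MOD 3] → a + 4 ≤ b)

/-- The admissible sequences with all entries at least `k`. -/
def chainsFrom (k : ℕ) : Set (List ℕ) := {l | l.IsChain Step ∧ ∀ y ∈ l, k ≤ y}

/-- The sequences that remain admissible when `k` is put in front. -/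
def chainsAfter (k : ℕ) : Set (List ℕ) := {l | (k :: l).IsChain Step}

theorem forall_mem_of_isChain_cons {a : ℕ} {l : List ℕ} (h : (a :: l).IsChain Step) :
    ∀ y ∈ l, a + 2 ≤ y := by
  induction l generalizing a with
  | nil => simp
  | cons b l ih =>
    rw [List.isChain_cons_cons] at h
    intro y hy
    have hab := h.1.1
    rcases List.mem_cons.1 hy with rfl | hy
    · exact hab
    · have := ih h.2 y hy
      omega

theorem mem_chainsFrom_cons {k a : ℕ} {l : List ℕ} :
    a :: l ∈ chainsFrom k ↔ (a :: l).IsChain Step ∧ k ≤ a := by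
  refine ⟨fun h => ⟨h.1, h.2 a (by simp)⟩, fun h => ⟨h.1, fun y hy => ?_⟩⟩
  rcases List.mem_cons.1 hy with rfl | hy
  · exact h.2
  · have := forall_mem_of_isChain_cons h.1 y hy
    have := h.2
    omega

theorem nil_mem_chainsFrom (k : ℕ) : [] ∈ chainsFrom k := by simp [chainsFrom]

theorem disjoint_chainsFrom_cons {k c : ℕ} (h : k < c) (P : Set (List ℕ)) :
    Disjoint (chainsFrom c) (List.cons k '' P) := by
  rw [Set.disjoint_left]
  rintro _ hl ⟨l, -, rfl⟩
  have := (mem_chainsFrom_cons.1 hl).2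
  omega

theorem chainsFrom_eq_union (k : ℕ) :
    chainsFrom k = chainsFrom (k + 1) ∪ List.cons k '' chainsAfter k := by
  ext l
  cases l with
  | nil => simp [nil_mem_chainsFrom]
  | cons a l =>
    simp only [Set.mem_union, mem_chainsFrom_cons, Set.mem_image, List.cons.injEq, chainsAfter,
      Set.mem_ofPred_eq]
    constructor
    · rintro ⟨h, hk⟩
      rcases hk.eq_or_lt with rfl | hk
      · exact Or.inr ⟨l, h, rfl, rfl⟩
      · exact Or.inl ⟨h, hk⟩
    · rintro (⟨h, hk⟩ | ⟨l, h, rfl, rfl⟩)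
      · exact ⟨h, by omega⟩
      · exact ⟨h, le_rfl⟩

theorem chainsAfter_eq_chainsFrom {k c : ℕ} (h : ∀ b, Step k b ↔ c ≤ b) :
    chainsAfter k = chainsFrom c := by
  ext l
  cases l with
  | nil => simp [nil_mem_chainsFrom, chainsAfter]
  | cons a l =>
    rw [mem_chainsFrom_cons, ← h, and_comm]
    exact List.isChain_cons_cons

theorem chainsAfter_eq_union {k b₀ c : ℕ} (h : ∀ b, Step k b ↔ c ≤ b ∨ b = b₀) :
    chainsAfter k = chainsFrom c ∪ List.cons b₀ '' chainsAfter b₀ := by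
  ext l
  cases l with
  | nil => simp [nil_mem_chainsFrom, chainsAfter]
  | cons a l =>
    simp only [Set.mem_union, mem_chainsFrom_cons, Set.mem_image, List.cons.injEq, chainsAfter,
      Set.mem_ofPred_eq, List.isChain_cons_cons, h]
    constructor
    · rintro ⟨hc | rfl, hl⟩
      · exact Or.inl ⟨hl, hc⟩
      · exact Or.inr ⟨l, hl, rfl, rfl⟩
    · rintro (⟨hl, hc⟩ | ⟨l, hl, rfl, rfl⟩)
      · exact ⟨Or.inl hc, hl⟩
      · exact ⟨Or.inr rfl, hl⟩

/-- A gap of 2 or 3 is allowed only if the sum is 2 mod 3: from residue 1 this permits gap 3, from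
residue 2 neither, from residue 0 gap 2 but not 3. -/
theorem step_one (t b : ℕ) : Step (3 * t + 1) b ↔ 3 * t + 4 ≤ b := by
  unfold Step Nat.ModEq
  omega

theorem step_two (t b : ℕ) : Step (3 * t + 2) b ↔ 3 * t + 6 ≤ b := by
  unfold Step Nat.ModEq
  omega

theorem step_three (t b : ℕ) : Step (3 * t + 3) b ↔ 3 * t + 7 ≤ b ∨ b = 3 * t + 5 := by
  unfold Step Nat.ModEq
  omega

theorem listGenFun_chainsFrom (k : ℕ) :
    listGenFun (chainsFrom k) =
      listGenFun (chainsFrom (k + 1)) + x * q ^ k * listGenFun (chainsAfter k) := by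
  rw [chainsFrom_eq_union, listGenFun_union (disjoint_chainsFrom_cons k.lt_succ_self _),
    listGenFun_cons]

theorem coeff_listGenFun_chainsFrom_of_lt {k : ℕ} (d : Fin 2 →₀ ℕ) (h : d 0 < k) :
    coeff d (listGenFun (chainsFrom k)) = coeff d 1 := by
  rw [coeff_listGenFun, coeff_one]
  have hnil : ∀ l ∈ chainsFrom k ∩ {l | l.sum = d 0 ∧ l.length = d 1}, l = [] := by
    rintro l ⟨hl, h0, -⟩
    cases l with
    | nil => rfl
    | cons a l =>
      have := (mem_chainsFrom_cons.1 hl).2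
      simp at h0
      omega
  split_ifs with hd
  · subst hd
    rw [Nat.cast_eq_one, Set.ncard_eq_one]
    exact ⟨[], Set.eq_singleton_iff_unique_mem.2 ⟨⟨nil_mem_chainsFrom k, by simp⟩, hnil⟩⟩
  · rw [Nat.cast_eq_zero, Set.ncard_eq_zero ((finite_setOf_sum_length _ _).inter_of_right _),
      Set.eq_empty_iff_forall_notMem]
    intro l hl
    obtain rfl := hnil l hl
    refine hd (Finsupp.ext fun i => ?_)
    fin_cases i
    · exact hl.2.1.symm
    · exact hl.2.2.symm

theorem isSolution_listGenFun :
    IsSolution (fun t => listGenFun (chainsFrom (3 * t + 1)))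
      (fun t => listGenFun (chainsFrom (3 * t + 2)))
      (fun t => listGenFun (chainsFrom (3 * t + 3))) where
  eq_A t := by
    rw [listGenFun_chainsFrom (3 * t + 1), chainsAfter_eq_chainsFrom (step_one t)]
    rfl
  eq_B t := by
    rw [listGenFun_chainsFrom (3 * t + 2), chainsAfter_eq_chainsFrom (step_two t)]
    rfl
  eq_C t := by
    rw [listGenFun_chainsFrom (3 * t + 3), chainsAfter_eq_union (step_three t),
      listGenFun_union (disjoint_chainsFrom_cons (by omega) _), listGenFun_cons,
      -- The exceptional successor `3 * t + 5` has residue 2, so the parts after it start at `3 * (t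
      -- + 2) + 3`.
      show 3 * t + 5 = 3 * (t + 1) + 2 by ring, chainsAfter_eq_chainsFrom (step_two (t + 1))]
    rfl
  coeff_A t d h := coeff_listGenFun_chainsFrom_of_lt d (by omega)

theorem Step.le {a b : ℕ} (h : Step a b) : a ≤ b := (Nat.le_add_right a 2).trans h.1

/-- Sorting identifies partitions with increasing lists; the bound 1 encodes positivity of the
parts. -/
theorem genFun_eq_listGenFun : genFun = listGenFun (chainsFrom 1) := by
  ext d
  rw [coeff_genFun, coeff_listGenFun, cp, ← Set.ncard_coe_finset]
  congr 1
  refine Set.ncard_congr (fun p _ => p.parts.sort (· ≤ ·)) ?_ ?_ ?_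
  · intro p hp
    simp only [Finset.coe_filter, Finset.mem_univ, true_and, Set.mem_ofPred_eq] at hp
    refine ⟨⟨hp.1, fun y hy => p.parts_pos ((Multiset.mem_sort _).1 hy)⟩, ?_, ?_⟩
    · rw [← Multiset.sum_coe, Multiset.sort_eq, p.parts_sum]
    · rw [Multiset.length_sort, hp.2]
  · intro p p' _ _ h
    ext1
    rw [← Multiset.sort_eq p.parts (· ≤ ·), h, Multiset.sort_eq]
  · rintro l ⟨⟨hchain, hpos⟩, hsum, hlen⟩
    have hsort : (l : Multiset ℕ).sort (· ≤ ·) = l := by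
      rw [Multiset.coe_sort]
      exact List.mergeSort_of_pairwise (by
        simpa using (hchain.imp fun _ _ => Step.le).pairwise)
    refine ⟨⟨l, fun hi => hpos _ hi, by simpa using hsum⟩, ?_, hsort⟩
    refine Finset.mem_coe.2 (Finset.mem_filter.2 ⟨Finset.mem_univ _, ?_, by simpa using hlen⟩)
    unfold Admissible
    rw [hsort]
    exact hchain

end CapparelliOneTwo

theorem mainTheorem7 :
    HasSum
      (fun n : ℕ × ℕ =>
        CapparelliOneTwo.q ^
            ((6 * n.2 ^ 2 - n.2) + (2 * n.1 ^ 2 - n.1) + 6 * n.2 * n.1) *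
          CapparelliOneTwo.x ^ (2 * n.2 + n.1) *
          CapparelliOneTwo.inverseDenominator n.1 n.2)
      CapparelliOneTwo.genFun := by
  have h := CapparelliOneTwo.hasSum_doubleSeries 0 0
  have hu := CapparelliOneTwo.isSolution_listGenFun.unique
    CapparelliOneTwo.isSolution_doubleSeries 0
  rw [CapparelliOneTwo.genFun_eq_listGenFun]
  simp only [mul_zero, zero_add] at hu
  rw [hu]
  refine h.congr_fun fun n => ?_
  simp only [CapparelliOneTwo.summand, zero_mul, add_zero]
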